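/- **Setting.** Let $d\in\mathbb N$ be fixed and let $\|\cdot\|$ be an arbitrary norm on $\mathbb R^d$. Let $\beta$ be the Besicovitch constant of $(\mathbb R^d,\|\cdot\|)$, i.e. the least number such that for every $P\subseteq\mathbb R^d$ and $\delta>0$ there are $\beta$ countable families of pairwise disjoint closed balls of radius $\delta$ with centers in $P$ whose union covers $P$. Let $\nu$ be a probability distribution on $\mathbb R^d$ having a density with respect to Lebesgue measure with finite essential supremum, and let $X_1,X_2,\dots$ be independent with distribution $\nu$. Let $r(n)>0$ with $r(n)\to0$, and let $q=q(n)\in[0,1]$. Write $r=r(n)$. The random geometric graph $G_n$ has vertices $X_1,\dots,X_n$, with $X_i,X_j$ ($i\ne j$) adjacent iff $\|X_i-X_j\|\le r$. Given the points, $G_n^{0,q}$ is obtained from $G_n$ by keeping all edges and inserting each non-existing edge independently with probability $q$. An edge $(u,v)$ of $G_n^{0,q}$ is a *long edge* if $\|u-v\|>3r$, and its *edge clique number* $\omega_{u,v}(G_n^{0,q})$ is the largest size of a clique of $G_n^{0,q}$ containing $u$ and $v$. We say that *with high probability every long edge has edge clique number $\lesssim k_n$* if there is a constant $C>0$ such that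 $$\lim_{n\to\infty}\mathbb P\big[\omega_{u,v}(G_n^{0,q})\le C\,k_n\text{ for all long edges }(u,v)\text{ of }G_n^{0,q}\big]=1 .$$ **Theorem 3.9.** Suppose that $n^{-\epsilon}\ll nr^d\ll\log n$ for all $\epsilon>0$, where $f\ll g$ means $f(n)/g(n)\to0$ as $n\to\infty$. (a) There exist constants $C_1,C_2>0$ depending only on the Besicovitch constant $\beta$ such that if $$q(n)\le C_1\left(\frac{nr^d}{\log n}\right)^{C_2}\quad\text{for all sufficiently large }n,$$ then with high probability every long edge $(u,v)$ of $G_n^{0,q}$ has edge clique number $$\omega_{u,v}(G_n^{0,q})\lesssim\frac{\log n}{\log\left(\log n/(nr^d)\right)} .$$ (b) There exists a constant $\xi>0$ depending only on the Besicovitch constant $\beta$ such that if $$\left(\frac{nr^d}{\log n}\right)^{\xi}\le q(n)<1\quad\text{for all sufficiently large }n,$$ then with high probability every long edge $(u,v)$ of $G_n^{0,q}$ has edge clique number $\omega_{u,v}(G_n^{0,q})\lesssim\log_{1/q}n$. -/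

import Mathlib

open MeasureTheory ProbabilityTheory Filter Topology

/-! ### Norms on `ℝ^d` and the Besicovitch constant

An arbitrary norm on `ℝ^d` is a seminorm `N` on `Fin d → ℝ` with `N x = 0 → x = 0`. -/

/-- The closed ball `B_s(x) = {y : N (y - x) ≤ s}`. -/
def normBall {d : ℕ} (N : Seminorm ℝ (Fin d → ℝ)) (x : Fin d → ℝ) (s : ℝ) : Set (Fin d → ℝ) :=
  {y | N (y - x) ≤ s}

/-- For every set `P` and every `δ > 0` there are `β` many `δ`-packings with respect to `P`
(countable families of pairwise disjoint closed balls of radius `δ` with centers in `P`) whose union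
covers `P`. The `i`-th packing is given by the set `c i` of the centers of its balls. -/
def IsBesicovitchConstant {d : ℕ} (N : Seminorm ℝ (Fin d → ℝ)) (β : ℕ) : Prop :=
  ∀ (P : Set (Fin d → ℝ)) (δ : ℝ), 0 < δ →
    ∃ c : Fin β → Set (Fin d → ℝ),
      (∀ i, c i ⊆ P ∧ (c i).Countable ∧ (c i).PairwiseDisjoint (fun x => normBall N x δ)) ∧
      P ⊆ ⋃ i, ⋃ x ∈ c i, normBall N x δ

theorem exists_packings_of_normed (E : Type*) [NormedAddCommGroup E] [NormedSpace ℝ E]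
    [FiniteDimensional ℝ E] :
    ∃ β : ℕ, ∀ (P : Set E) (δ : ℝ), 0 < δ →
      ∃ c : Fin β → Set E,
        (∀ i, c i ⊆ P ∧ (c i).Countable ∧
          (c i).PairwiseDisjoint (fun x => {y : E | ‖y - x‖ ≤ δ})) ∧
        P ⊆ ⋃ i, ⋃ x ∈ c i, {y : E | ‖y - x‖ ≤ δ} := by
  obtain ⟨β, τ, hτ, hemp⟩ := HasBesicovitchCovering.no_satelliteConfig (α := E)
  have hball : ∀ (x : E) (δ : ℝ), {y : E | ‖y - x‖ ≤ δ} = Metric.closedBall x δ := by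
    intro x δ
    ext y
    simp [dist_eq_norm]
  refine ⟨β, fun P δ hδ => ?_⟩
  simp only [hball]
  let pk : Besicovitch.BallPackage P E :=
    { c := fun x => x
      r := fun _ => δ
      rpos := fun _ => hδ
      r_bound := δ
      r_le := fun _ => le_refl _ }
  obtain ⟨s, hs, hcov⟩ := Besicovitch.exist_disjoint_covering_families hτ hemp pk
  have hdisj : ∀ i, (Subtype.val '' s i).PairwiseDisjoint
      (fun x : E => Metric.closedBall x δ) := by
    rintro i _ ⟨x, hx, rfl⟩ _ ⟨y, hy, rfl⟩ hxy
    exact hs i hx hy (fun h => hxy (congrArg _ h))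
  refine ⟨fun i => Subtype.val '' s i, fun i => ⟨?_, ?_, hdisj i⟩, ?_⟩
  · rintro _ ⟨x, -, rfl⟩
    exact x.2
  · refine (hdisj i).countable_of_nonempty_interior (fun x _ => ?_)
    exact ⟨x, Metric.ball_subset_interior_closedBall (Metric.mem_ball_self hδ)⟩
  · intro x hx
    have h := hcov ⟨⟨x, hx⟩, rfl⟩
    simp only [Set.mem_iUnion] at h ⊢
    obtain ⟨i, j, hj, hxj⟩ := h
    exact ⟨i, j, ⟨j, hj, rfl⟩, Metric.ball_subset_closedBall hxj⟩

/-- The Besicovitch covering lemma for balls of equal radius: the set of which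
`besicovitchConstant` is the least element is non-empty. -/
theorem exists_isBesicovitchConstant {d : ℕ} (N : Seminorm ℝ (Fin d → ℝ))
    (hN : ∀ x, N x = 0 → x = 0) : ∃ β : ℕ, IsBesicovitchConstant N β := by
  let g : AddGroupNorm (Fin d → ℝ) :=
    { toFun := N
      map_zero' := map_zero N
      add_le' := map_add_le_add N
      neg' := map_neg_eq_map N
      eq_zero_of_map_eq_zero' := hN }
  let i₁ : NormedAddCommGroup (Fin d → ℝ) := g.toNormedAddCommGroup
  let i₂ : @NormedSpace ℝ (Fin d → ℝ) _ i₁.toSeminormedAddCommGroup :=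
    @NormedSpace.mk ℝ (Fin d → ℝ) _ i₁.toSeminormedAddCommGroup (Pi.module _ _ _)
      (fun a x => (map_smul_eq_mul N a x).le)
  have i₃ : @FiniteDimensional ℝ (Fin d → ℝ) _ _ i₂.toModule :=
    (inferInstance : @FiniteDimensional ℝ (Fin d → ℝ) _ _ (Pi.module _ _ _))
  exact @exists_packings_of_normed (Fin d → ℝ) i₁ i₂ i₃

/-- The Besicovitch constant of `(ℝ^d, N)`: the least number of packings that always suffices. -/
noncomputable def besicovitchConstant {d : ℕ} (N : Seminorm ℝ (Fin d → ℝ)) : ℕ :=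
  sInf {β | IsBesicovitchConstant N β}

/-! ### Noisy random geometric graphs -/

/-- The distribution `ν` on `ℝ^d` has a density with respect to Lebesgue measure whose essential
supremum (the maximum density of `ν`) is finite. -/
def HasFiniteMaxDensity {d : ℕ} (ν : Measure (Fin d → ℝ)) : Prop :=
  ∃ f : (Fin d → ℝ) → ENNReal, Measurable f ∧ ν = volume.withDensity f ∧ essSup f volume < ⊤

/-- The geometric graph on the points `x 0, …, x (n - 1)`: distinct vertices `i`, `j` are adjacent
when `N (x i - x j) ≤ r`. -/
def geometricGraph {d n : ℕ} (N : Seminorm ℝ (Fin d → ℝ)) (r : ℝ) (x : Fin n → Fin d → ℝ) :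
    SimpleGraph (Fin n) where
  Adj i j := i ≠ j ∧ N (x i - x j) ≤ r
  symm := ⟨fun i j h => ⟨h.1.symm, by rw [map_sub_rev N]; exact h.2⟩⟩
  loopless := ⟨fun _ h => h.1 rfl⟩

/-- Delete from `G` the edges in `D`, and insert the non-edges of `G` in `I`. -/
def perturb {V : Type*} (G : SimpleGraph V) (D I : Set (Sym2 V)) : SimpleGraph V :=
  G.deleteEdges D ⊔ (SimpleGraph.fromEdgeSet I \ G)

/-- A sample: the positions of the `n` points, the set of pairs selected for deletion, and the set
of pairs selected for insertion. -/
abbrev NoisySample (d n : ℕ) : Type :=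
  (Fin n → Fin d → ℝ) × (Set (Sym2 (Fin n)) × Set (Sym2 (Fin n)))

/-- The law of a sample: the points are i.i.d. with distribution `ν`, each pair of distinct vertices
is selected for deletion with probability `p` and for insertion with probability `q`, and all these
choices are independent of each other and of the points. A deletion is only carried out at an edge
of the geometric graph, an insertion only at a non-edge, so that, given the points, edges are
deleted independently with probability `p` and non-edges inserted independently with
probability `q`. -/
noncomputable def noisyLaw {d : ℕ} (ν : Measure (Fin d → ℝ)) (p q : unitInterval) (n : ℕ) :
    Measure (NoisySample d n) :=
  (Measure.pi fun _ : Fin n => ν).prod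
    ((setBernoulli (Sym2.diagSet)ᶜ p).prod (setBernoulli (Sym2.diagSet)ᶜ q))

/-- The `(p, q)`-perturbed noisy random geometric graph as a function of the sample. -/
def noisyGraph {d n : ℕ} (N : Seminorm ℝ (Fin d → ℝ)) (r : ℝ) (ω : NoisySample d n) :
    SimpleGraph (Fin n) :=
  perturb (geometricGraph N r ω.1) ω.2.1 ω.2.2

/-- `(u, v)` is a long edge: an edge of the noisy graph with `N (x u - x v) > 3 r`. -/
def IsLongEdge {d n : ℕ} (N : Seminorm ℝ (Fin d → ℝ)) (r : ℝ) (ω : NoisySample d n)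
    (u v : Fin n) : Prop :=
  (noisyGraph N r ω).Adj u v ∧ 3 * r < N (ω.1 u - ω.1 v)

/-- The edge clique number `ω_{u,v}(G)`: the largest size of a clique of `G` containing `u`
and `v`. -/
noncomputable def edgeCliqueNum {V : Type*} (G : SimpleGraph V) (u v : V) : ℕ :=
  sSup {k | ∃ s : Finset V, G.IsNClique k s ∧ u ∈ s ∧ v ∈ s}

/-! ### Asymptotics -/

/-- `f ≪ g`. -/
def MuchLess (f g : ℕ → ℝ) : Prop :=
  Tendsto (fun n => f n / g n) atTop (𝓝 0)

/-- `n^{-ε} ≪ n r^d ≪ log n` for all `ε > 0`. -/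
def IntermediateRegime (d : ℕ) (r : ℕ → ℝ) : Prop :=
  (∀ ε : ℝ, 0 < ε → MuchLess (fun n => (n : ℝ) ^ (-ε)) (fun n => (n : ℝ) * r n ^ d)) ∧
    MuchLess (fun n => (n : ℝ) * r n ^ d) (fun n => Real.log n)

/-- With high probability, all long edges `(u, v)` of the `(0, q n)`-perturbed noisy random
geometric graph on `n` points have edge clique number `≲ k n`. -/
def LongEdgeCliqueBound {d : ℕ} (N : Seminorm ℝ (Fin d → ℝ)) (ν : Measure (Fin d → ℝ))
    (r : ℕ → ℝ) (q : ℕ → unitInterval) (k : ℕ → ℝ) : Prop :=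
  ∃ C : ℝ, 0 < C ∧
    Tendsto
      (fun n : ℕ => noisyLaw ν 0 (q n) n
        {ω | ∀ u v : Fin n, IsLongEdge N (r n) ω u v →
          (edgeCliqueNum (noisyGraph N (r n) ω) u v : ℝ) ≤ C * k n})
      atTop (𝓝 1)

/-! Write `L = log n` and `t = L / (n r^d)`, which tends to infinity. Sparsity: with high
probability no point has `a ≈ 4 L / log t` others within distance `r`, by a first-moment bound
(`pi_not_sparseBalls_le`, `nat_mul_choose_mul_pow_le`). Then each vertex of a `k`-set has at least
`k - a` partners in the set at distance more than `r`, so the set has at least `k (k - a) / 2` far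
pairs (`card_farPairs_ge`). In a clique all of them were inserted, which given the points has
probability at most `q ^ (k (k - a) / 2)`. If `m ≥ L / log t` and `q ≤ exp (-L / m)`, then for `k ≈
10 m` this beats the at most `n ^ k` choices of the set (`choose_mul_exp_le`). So all cliques, hence
those through long edges, have size at most `10 m`. Part (a) is `m = L / log t`, where the condition
reads `q ≤ 1 / t`; part (b) is `m = log_{1/q} n`, where `q ≥ 1 / t` gives `m ≥ L / log t`. -/

/-! ### Measure of norm balls -/

theorem continuous_seminorm_pi {d : ℕ} (N : Seminorm ℝ (Fin d → ℝ)) : Continuous N := by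
  have h : ConvexOn ℝ Set.univ N := N.convexOn
  exact continuousOn_univ.1 (h.continuousOn isOpen_univ)

theorem exists_norm_le_mul_seminorm {d : ℕ} (N : Seminorm ℝ (Fin d → ℝ))
    (hN : ∀ x, N x = 0 → x = 0) : ∃ K : ℝ, 0 ≤ K ∧ ∀ x, ‖x‖ ≤ K * N x := by
  rcases (Metric.sphere (0 : Fin d → ℝ) 1).eq_empty_or_nonempty with h | h
  -- An empty unit sphere means that the space is trivial (`d = 0`).
  · refine ⟨0, le_rfl, fun x => ?_⟩
    by_contra! hx
    have hx' : 0 < ‖x‖ := by simpa using hx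
    have : ‖x‖⁻¹ • x ∈ Metric.sphere (0 : Fin d → ℝ) 1 := by
      simp [norm_smul, hx'.ne']
    simp [h] at this
  · obtain ⟨y, hy, hmin⟩ := (isCompact_sphere (0 : Fin d → ℝ) 1).exists_isMinOn h
      (continuous_seminorm_pi N).continuousOn
    have hy0 : 0 < N y := by
      refine lt_of_le_of_ne (apply_nonneg N y) fun h0 => ?_
      rw [hN y h0.symm] at hy
      simp at hy
    refine ⟨(N y)⁻¹, by positivity, fun x => ?_⟩
    rcases eq_or_ne x 0 with rfl | hx
    · simp
    have hx' : 0 < ‖x‖ := norm_pos_iff.2 hx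
    have hs : ‖x‖⁻¹ • x ∈ Metric.sphere (0 : Fin d → ℝ) 1 := by
      simp [norm_smul, hx'.ne']
    have h1 : N y ≤ N (‖x‖⁻¹ • x) := hmin hs
    rw [map_smul_eq_mul, norm_inv, norm_norm, inv_mul_eq_div, le_div_iff₀ hx'] at h1
    rw [inv_mul_eq_div, le_div_iff₀ hy0]
    linarith

theorem exists_measure_normBall_le {d : ℕ} (N : Seminorm ℝ (Fin d → ℝ))
    (hN : ∀ x, N x = 0 → x = 0) (ν : Measure (Fin d → ℝ)) (hν : HasFiniteMaxDensity ν) :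
    ∃ c : ℝ, 0 < c ∧ ∀ x s, 0 < s → ν (normBall N x s) ≤ ENNReal.ofReal (c * s ^ d) := by
  obtain ⟨K, hK0, hK⟩ := exists_norm_le_mul_seminorm N hN
  obtain ⟨f, -, rfl, hf⟩ := hν
  set V : ENNReal := essSup f volume *
    (ENNReal.ofReal (K ^ d) * volume (Metric.closedBall (0 : Fin d → ℝ) 1))
  have hV : V ≠ ⊤ := ENNReal.mul_ne_top hf.ne
    (ENNReal.mul_ne_top ENNReal.ofReal_ne_top (measure_closedBall_lt_top).ne)
  refine ⟨V.toReal + 1, by positivity, fun x s hs => ?_⟩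
  have hcl : IsClosed (normBall N x s) :=
    isClosed_le ((continuous_seminorm_pi N).comp (by fun_prop)) continuous_const
  have hsub : normBall N x s ⊆ Metric.closedBall x (K * s) := by
    intro y hy
    rw [Metric.mem_closedBall, dist_eq_norm]
    exact (hK _).trans (mul_le_mul_of_nonneg_left hy hK0)
  calc (volume.withDensity f) (normBall N x s)
      = ∫⁻ y in normBall N x s, f y := withDensity_apply _ hcl.measurableSet
    _ ≤ ∫⁻ y in normBall N x s, essSup f volume :=
        lintegral_mono_ae (ae_restrict_of_ae (ENNReal.ae_le_essSup f))
    _ = essSup f volume * volume (normBall N x s) := by simp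
    _ ≤ essSup f volume * volume (Metric.closedBall x (K * s)) := by gcongr
    _ = V * ENNReal.ofReal (s ^ d) := by
        rw [Measure.addHaar_closedBall' _ _ (by positivity), Module.finrank_fin_fun, mul_pow,
          ENNReal.ofReal_mul (by positivity)]
        ring
    _ ≤ ENNReal.ofReal (V.toReal + 1) * ENNReal.ofReal (s ^ d) := by
        gcongr
        rw [ENNReal.le_ofReal_iff_toReal_le hV (by positivity)]
        linarith
    _ = ENNReal.ofReal ((V.toReal + 1) * s ^ d) := by
        rw [ENNReal.ofReal_mul (by positivity)]

/-! ### Probabilities of the elementary events -/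

/-- Memberships are independent. Only an inequality holds, because elements outside `u` are never
selected. -/
theorem setBernoulli_superset_le {ι : Type*} [Countable ι] (u : Set ι) (q : unitInterval)
    (S : Finset ι) : setBernoulli u q {I | ∀ e ∈ S, e ∈ I} ≤ ENNReal.ofReal q ^ S.card := by
  classical
  rw [setBernoulli_apply']
  have : ((fun p : ι → Prop => {i | p i}) ⁻¹' {I | ∀ e ∈ S, e ∈ I}) =
      Set.pi (S : Set ι) (fun _ => {True}) := by
    ext p
    simp [Set.mem_pi]
  rw [this, Measure.infinitePi_pi _ (by measurability), ← Finset.prod_const]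
  refine Finset.prod_le_prod' fun i _ => ?_
  have hq : ENNReal.ofReal (q : ℝ) = (unitInterval.toNNReal q : ENNReal) := by
    rw [ENNReal.ofReal]
    congr 1
    exact Real.toNNReal_of_nonneg q.2.1
  rw [hq]
  simp only [Measure.add_apply, Measure.smul_apply, Measure.dirac_apply, ENNReal.smul_def]
  by_cases hi : i ∈ u <;> simp [hi]

/-- Split off coordinate `i` and freeze it at `y`: the remaining points are independent and the
event becomes a box. This needs `i ∉ S`. -/
theorem pi_forall_mem_normBall_le {d n : ℕ} (N : Seminorm ℝ (Fin d → ℝ))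
    (ν : Measure (Fin d → ℝ)) [IsProbabilityMeasure ν] (s : ℝ) (p : ENNReal)
    (hp : ∀ x, ν (normBall N x s) ≤ p) (i : Fin n) (S : Finset (Fin n)) (hi : i ∉ S) :
    Measure.pi (fun _ : Fin n => ν) {x | ∀ j ∈ S, x j ∈ normBall N (x i) s} ≤ p ^ S.card := by
  classical
  cases n with
  | zero => exact i.elim0
  | succ n =>
    have hmeas : MeasurableSet {x : Fin (n + 1) → Fin d → ℝ |
        ∀ j ∈ S, x j ∈ normBall N (x i) s} := by
      have : {x : Fin (n + 1) → Fin d → ℝ | ∀ j ∈ S, x j ∈ normBall N (x i) s} =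
          ⋂ j ∈ S, {x | N (x j - x i) ≤ s} := by
        ext; simp [normBall]
      rw [this]
      exact (isClosed_biInter fun j _ => isClosed_le ((continuous_seminorm_pi N).comp
        (by fun_prop)) continuous_const).measurableSet
    have hmp := (measurePreserving_piFinSuccAbove (fun _ : Fin (n + 1) => ν) i).symm
    rw [← hmp.measure_preimage hmeas.nullMeasurableSet,
      Measure.prod_apply (hmp.measurable hmeas)]
    have hbound : ∀ y : Fin d → ℝ, Measure.pi (fun _ : Fin n => ν)
        (Prod.mk y ⁻¹' ((MeasurableEquiv.piFinSuccAbove (fun _ : Fin (n + 1) => Fin d → ℝ) i).symm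
          ⁻¹' {x | ∀ j ∈ S, x j ∈ normBall N (x i) s})) ≤ p ^ S.card := by
      intro y
      have hsub : (Prod.mk y ⁻¹'
          ((MeasurableEquiv.piFinSuccAbove (fun _ : Fin (n + 1) => Fin d → ℝ) i).symm
          ⁻¹' {x | ∀ j ∈ S, x j ∈ normBall N (x i) s})) ⊆
          Set.pi Set.univ (fun j : Fin n =>
            if i.succAbove j ∈ S then normBall N y s else Set.univ) := by
        intro z hz j _
        dsimp only
        split_ifs with h
        · have := hz _ h
          simpa [MeasurableEquiv.piFinSuccAbove_symm_apply, Fin.insertNthEquiv] using this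
        · trivial
      refine (measure_mono hsub).trans ?_
      rw [Measure.pi_pi]
      have hcard : (Finset.univ.filter fun j : Fin n => i.succAbove j ∈ S).card = S.card := by
        rw [← Finset.card_map i.succAboveEmb]
        congr 1
        ext j
        simp only [Finset.mem_map, Finset.mem_filter, Finset.mem_univ, true_and]
        constructor
        · rintro ⟨k, hk, rfl⟩; exact hk
        · intro hj
          obtain ⟨k, rfl⟩ := Fin.exists_succAbove_eq (y := i) (x := j) (fun h => hi (h ▸ hj))
          exact ⟨k, hj, rfl⟩
      calc ∏ j : Fin n, ν (if i.succAbove j ∈ S then normBall N y s else Set.univ)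
          ≤ ∏ j : Fin n, (if i.succAbove j ∈ S then p else 1) := by
            refine Finset.prod_le_prod' fun j _ => ?_
            split_ifs
            · exact hp y
            · simp
        _ = p ^ S.card := by
            rw [Finset.prod_ite, Finset.prod_const, Finset.prod_const_one, mul_one, hcard]
    refine (lintegral_mono hbound).trans ?_
    simp

/-! ### Sparse balls, far pairs and cliques -/

/-- No ball of radius `r` around one of the points contains `a` further points. -/
def SparseBalls {d n : ℕ} (N : Seminorm ℝ (Fin d → ℝ)) (r : ℝ) (a : ℕ)
    (x : Fin n → Fin d → ℝ) : Prop :=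
  ∀ (i : Fin n) (S : Finset (Fin n)), i ∉ S → S.card = a → ¬ ∀ j ∈ S, x j ∈ normBall N (x i) r

open Classical in
/-- The pairs of points of `K` at distance more than `r`. -/
noncomputable def farPairs {d n : ℕ} (N : Seminorm ℝ (Fin d → ℝ)) (r : ℝ)
    (x : Fin n → Fin d → ℝ) (K : Finset (Fin n)) : Finset (Sym2 (Fin n)) :=
  ((K ×ˢ K).filter fun z => r < N (x z.1 - x z.2)).image fun z => s(z.1, z.2)

theorem forall_mem_farPairs {d n : ℕ} {N : Seminorm ℝ (Fin d → ℝ)} {r : ℝ}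
    {x : Fin n → Fin d → ℝ} {K : Finset (Fin n)} {I : Set (Sym2 (Fin n))} :
    (∀ e ∈ farPairs N r x K, e ∈ I) ↔
      ∀ i ∈ K, ∀ j ∈ K, r < N (x i - x j) → s(i, j) ∈ I := by
  classical
  simp only [farPairs, Finset.mem_image, Finset.mem_filter, Finset.mem_product]
  constructor
  · intro h i hi j hj hij
    exact h _ ⟨(i, j), ⟨⟨hi, hj⟩, hij⟩, rfl⟩
  · rintro h _ ⟨⟨i, j⟩, ⟨⟨hi, hj⟩, hij⟩, rfl⟩
    exact h i hi j hj hij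

theorem pi_not_sparseBalls_le {d n : ℕ} (N : Seminorm ℝ (Fin d → ℝ))
    (ν : Measure (Fin d → ℝ)) [IsProbabilityMeasure ν] (r : ℝ) (p : ENNReal)
    (hp : ∀ x, ν (normBall N x r) ≤ p) (a : ℕ) :
    Measure.pi (fun _ : Fin n => ν) {x | ¬ SparseBalls N r a x} ≤ n * (n.choose a * p ^ a) := by
  classical
  have hsub : {x : Fin n → Fin d → ℝ | ¬ SparseBalls N r a x} ⊆
      ⋃ i : Fin n, ⋃ S ∈ (Finset.univ.powersetCard a).filter (fun S => i ∉ S),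
        {x | ∀ j ∈ S, x j ∈ normBall N (x i) r} := by
    intro x hx
    rw [Set.mem_ofPred_eq, SparseBalls] at hx
    push Not at hx
    obtain ⟨i, S, hi, hS, h⟩ := hx
    simp only [Set.mem_iUnion]
    exact ⟨i, S, by simp [hi, hS, Finset.mem_powersetCard], fun j hj => h j hj⟩
  calc Measure.pi (fun _ : Fin n => ν) {x | ¬ SparseBalls N r a x}
      ≤ ∑ i : Fin n, ∑ S ∈ (Finset.univ.powersetCard a).filter (fun S => i ∉ S), p ^ a := by
        refine (measure_mono hsub).trans ((measure_iUnion_fintype_le _ _).trans ?_)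
        refine Finset.sum_le_sum fun i _ => (measure_biUnion_finset_le _ _).trans ?_
        refine Finset.sum_le_sum fun S hS => ?_
        rw [Finset.mem_filter, Finset.mem_powersetCard] at hS
        rw [← hS.1.2]
        exact pi_forall_mem_normBall_le N ν r p hp i S hS.2
    _ ≤ ∑ i : Fin n, ∑ S ∈ (Finset.univ : Finset (Fin n)).powersetCard a, p ^ a := by
        refine Finset.sum_le_sum fun i _ => ?_
        exact Finset.sum_le_sum_of_subset (Finset.filter_subset _ _)
    _ = n * (n.choose a * p ^ a) := by simp

/-- By sparsity at most `a` members of `K`, `i` itself included, are within `r` of a given `i ∈ K`.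
Summing over `i` counts ordered far pairs, and each unordered pair arises at most twice. -/
theorem card_farPairs_ge {d n : ℕ} {N : Seminorm ℝ (Fin d → ℝ)} {r : ℝ} {a : ℕ}
    {x : Fin n → Fin d → ℝ} (hx : SparseBalls N r a x) (K : Finset (Fin n)) :
    K.card * (K.card - a) ≤ 2 * (farPairs N r x K).card := by
  classical
  have h1 : ∀ i ∈ K, K.card - a ≤ (K.filter fun j => r < N (x i - x j)).card := by
    intro i hi
    have hsplit := Finset.card_filter_add_card_filter_not (s := K)
      (fun j => r < N (x i - x j))
    suffices h : (K.filter fun j => ¬ r < N (x i - x j)).card ≤ a by omega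
    by_contra hlt
    rw [not_le] at hlt
    have hle : a ≤ ((K.filter fun j => ¬ r < N (x i - x j)).erase i).card := by
      have := Finset.pred_card_le_card_erase (s := K.filter fun j => ¬ r < N (x i - x j)) (a := i)
      omega
    obtain ⟨S, hS, hSa⟩ := Finset.exists_subset_card_eq hle
    refine hx i S (fun h => by simpa using hS h) hSa fun j hj => ?_
    have := hS hj
    simp only [Finset.mem_erase, Finset.mem_filter, not_lt] at this
    simpa [normBall, map_sub_rev N (x j)] using this.2.2
  have h2 : K.card * (K.card - a) ≤
      ((K ×ˢ K).filter fun z => r < N (x z.1 - x z.2)).card := by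
    have : ((K ×ˢ K).filter fun z => r < N (x z.1 - x z.2)).card =
        ∑ i ∈ K, (K.filter fun j => r < N (x i - x j)).card := by
      simp only [Finset.card_filter, Finset.sum_product]
    rw [this]
    simpa using Finset.card_nsmul_le_sum K _ _ h1
  refine h2.trans (Finset.card_le_mul_card_image _ 2 fun e he => ?_)
  induction e using Sym2.ind with
  | _ u v =>
    refine (Finset.card_le_card (t := {(u, v), (v, u)}) fun z hz => ?_).trans Finset.card_le_two
    have := (Finset.mem_filter.1 hz).2
    simp only [Sym2.eq_iff] at this
    simp only [Finset.mem_insert, Finset.mem_singleton, Prod.ext_iff]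
    exact this

theorem measurableSet_sparse_and_inserted {d n : ℕ} (N : Seminorm ℝ (Fin d → ℝ)) (r : ℝ) (a : ℕ)
    (K : Finset (Fin n)) :
    MeasurableSet {ω : NoisySample d n | SparseBalls N r a ω.1 ∧
      ∀ e ∈ farPairs N r ω.1 K, e ∈ ω.2.2} := by
  have hdist : ∀ i j : Fin n, Measurable fun ω : NoisySample d n => N (ω.1 i - ω.1 j) := fun i j =>
    (continuous_seminorm_pi N).measurable.comp (by fun_prop)
  simp only [forall_mem_farPairs, SparseBalls, normBall, Set.mem_ofPred_eq]
  refine measurableSet_setOfPred.2 (Measurable.and ?_ ?_)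
  · refine Measurable.forall fun i => Measurable.forall fun S => measurable_const.imp
      (measurable_const.imp (Measurable.not (Measurable.forall fun j => measurable_const.imp ?_)))
    exact measurableSet_setOfPred.1 (measurableSet_le (hdist j i) measurable_const)
  · refine Measurable.forall fun i => measurable_const.imp (Measurable.forall fun j =>
      measurable_const.imp (Measurable.imp ?_ ?_))
    · exact measurableSet_setOfPred.1 (measurableSet_lt measurable_const (hdist i j))
    · exact (measurable_set_mem _).comp (measurable_snd.comp measurable_snd)

/-- By Fubini the points can be fixed: the set of far pairs is then deterministic, and insertions
are independent of the points. -/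
theorem noisyLaw_sparse_and_inserted_le {d n : ℕ} (N : Seminorm ℝ (Fin d → ℝ))
    (ν : Measure (Fin d → ℝ)) [IsProbabilityMeasure ν] (r : ℝ) (a : ℕ) (p q : unitInterval)
    (θ : ℝ) (hθ : 0 ≤ θ) (hq : (q : ℝ) ≤ Real.exp (-θ)) (K : Finset (Fin n)) :
    noisyLaw ν p q n {ω | SparseBalls N r a ω.1 ∧ ∀ e ∈ farPairs N r ω.1 K, e ∈ ω.2.2} ≤
      ENNReal.ofReal (Real.exp (-(θ * (K.card * ((K.card : ℝ) - a) / 2)))) := by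
  rw [noisyLaw, Measure.prod_apply (measurableSet_sparse_and_inserted N r a K)]
  refine (lintegral_mono (g := fun _ =>
    ENNReal.ofReal (Real.exp (-(θ * (K.card * ((K.card : ℝ) - a) / 2))))) fun x => ?_).trans
    (by simp)
  by_cases hx : SparseBalls N r a x
  · have hset : (Prod.mk x ⁻¹' {ω : NoisySample d n | SparseBalls N r a ω.1 ∧
        ∀ e ∈ farPairs N r ω.1 K, e ∈ ω.2.2}) =
        Set.univ ×ˢ {I | ∀ e ∈ farPairs N r x K, e ∈ I} := by
      ext; simp [hx]
    rw [hset, Measure.prod_prod, measure_univ, one_mul]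
    refine (setBernoulli_superset_le _ q _).trans ?_
    rw [← ENNReal.ofReal_pow q.2.1]
    refine ENNReal.ofReal_le_ofReal ((pow_le_pow_left₀ q.2.1 hq _).trans ?_)
    rw [← Real.exp_nat_mul, Real.exp_le_exp]
    have h : ((K.card * (K.card - a) : ℕ) : ℝ) ≤ ((2 * (farPairs N r x K).card : ℕ) : ℝ) :=
      Nat.cast_le.2 (card_farPairs_ge hx K)
    -- Truncated subtraction only helps: for `K.card < a` the real exponent is nonpositive in the
    -- far-pair count and the bound stays valid.
    have h' : (K.card : ℝ) - a ≤ ((K.card - a : ℕ) : ℝ) := by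
      rw [sub_le_iff_le_add]
      exact_mod_cast le_tsub_add
    push_cast at h
    have h'' := mul_le_mul_of_nonneg_left h' (Nat.cast_nonneg (α := ℝ) K.card)
    have := mul_le_mul_of_nonneg_left (h''.trans h) hθ
    linarith
  · have hset : (Prod.mk x ⁻¹' {ω : NoisySample d n | SparseBalls N r a ω.1 ∧
        ∀ e ∈ farPairs N r ω.1 K, e ∈ ω.2.2}) = ∅ := by
      ext; simp [hx]
    rw [hset]
    simp

/-- A clique of size at least `k` contains a `k`-subset, and its far pairs, not being geometric
edges, must have been inserted. -/
theorem edgeCliqueNum_noisyGraph_lt {d n : ℕ} {N : Seminorm ℝ (Fin d → ℝ)} {r : ℝ} {k : ℕ}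
    (hk : 0 < k) {ω : NoisySample d n}
    (h : ∀ K : Finset (Fin n), K.card = k → ¬ ∀ e ∈ farPairs N r ω.1 K, e ∈ ω.2.2)
    (hr : 0 ≤ r) (u v : Fin n) : edgeCliqueNum (noisyGraph N r ω) u v < k := by
  have hbd : ∀ l ∈ {l | ∃ s : Finset (Fin n), (noisyGraph N r ω).IsNClique l s ∧ u ∈ s ∧ v ∈ s},
      l ≤ k - 1 := by
    rintro l ⟨s, hs, -, -⟩
    by_contra! hl
    obtain ⟨K, hKs, hK⟩ := Finset.exists_subset_card_eq (s := s) (n := k) (by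
      rw [hs.card_eq]; omega)
    refine h K hK (forall_mem_farPairs.2 fun i hi j hj hij => ?_)
    have hne : i ≠ j := by
      rintro rfl
      simp at hij
      linarith
    have hadj := hs.isClique (hKs hi) (hKs hj) hne
    simp only [noisyGraph, perturb, SimpleGraph.sup_adj, SimpleGraph.deleteEdges_adj,
      SimpleGraph.sdiff_adj, SimpleGraph.fromEdgeSet_adj, geometricGraph] at hadj
    rcases hadj with hadj | hadj
    · exact absurd hadj.1.2 (not_le.2 hij)
    · exact hadj.1.1
  -- If no clique contains both vertices, the supremum is `0`, whence `0 < k`.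
  rcases Set.eq_empty_or_nonempty
    {l | ∃ s : Finset (Fin n), (noisyGraph N r ω).IsNClique l s ∧ u ∈ s ∧ v ∈ s} with h0 | h0
  · rw [edgeCliqueNum, h0]
    simpa using hk
  · have := csSup_le h0 hbd
    rw [edgeCliqueNum]
    omega

theorem noisyLaw_exists_le_edgeCliqueNum_le {d n : ℕ} (N : Seminorm ℝ (Fin d → ℝ))
    (ν : Measure (Fin d → ℝ)) [IsProbabilityMeasure ν] (r : ℝ) (hr : 0 ≤ r) (a k : ℕ)
    (hk : 0 < k) (p q : unitInterval) (θ : ℝ) (hθ : 0 ≤ θ) (hq : (q : ℝ) ≤ Real.exp (-θ))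
    (b : ENNReal) (hb : ∀ x, ν (normBall N x r) ≤ b) :
    noisyLaw ν p q n {ω | ∃ u v, k ≤ edgeCliqueNum (noisyGraph N r ω) u v} ≤
      n * (n.choose a * b ^ a) +
        n.choose k * ENNReal.ofReal (Real.exp (-(θ * (k * ((k : ℝ) - a) / 2)))) := by
  have hsub : {ω : NoisySample d n | ∃ u v, k ≤ edgeCliqueNum (noisyGraph N r ω) u v} ⊆
      ({x | ¬ SparseBalls N r a x} ×ˢ Set.univ) ∪
      ⋃ K ∈ (Finset.univ : Finset (Fin n)).powersetCard k,
        {ω | SparseBalls N r a ω.1 ∧ ∀ e ∈ farPairs N r ω.1 K, e ∈ ω.2.2} := by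
    rintro ω ⟨u, v, huv⟩
    by_contra hω
    simp only [Set.mem_union, Set.mem_prod, Set.mem_ofPred_eq, Set.mem_univ, and_true,
      Set.mem_iUnion, Finset.mem_powersetCard, Finset.subset_univ, true_and, not_or, not_not,
      not_exists] at hω
    exact absurd huv (not_le.2 (edgeCliqueNum_noisyGraph_lt hk
      (fun K hK h => hω.2 K hK ⟨hω.1, h⟩) hr u v))
  refine (measure_mono hsub).trans ((measure_union_le _ _).trans (add_le_add ?_ ?_))
  · rw [noisyLaw, Measure.prod_prod, measure_univ, mul_one]
    exact pi_not_sparseBalls_le N ν r b hb a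
  · refine (measure_biUnion_finset_le _ _).trans ?_
    refine (Finset.sum_le_sum (g := fun _ =>
      ENNReal.ofReal (Real.exp (-(θ * (k * ((k : ℝ) - a) / 2))))) fun K hK => ?_).trans (by simp)
    have := noisyLaw_sparse_and_inserted_le N ν r a p q θ hθ hq K
    rwa [(Finset.mem_powersetCard.1 hK).2] at this

/-! ### Numerical estimates for the two union bounds -/

/-- From `n.choose a ≤ n ^ a / a!` and `a ^ a / a! ≤ e ^ a` the left side is at most `n (e c L / (t
a)) ^ a`. As `a ≥ 4 L / log t`, the base is at most `t ^ (-1/2)`, and its `a`-th power at most `n ^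
(-2)`. -/
theorem nat_mul_choose_mul_pow_le {n : ℕ} {c t : ℝ} (hn : 2 ≤ n) (hc : 0 < c) (ht : 1 < t)
    (hct : Real.exp 1 * c / 4 * Real.log t / t ≤ Real.exp (-(Real.log t / 2))) :
    (n : ℝ) * (n.choose ⌈4 * (Real.log n / Real.log t)⌉₊ *
      (c * (Real.log n / (n * t))) ^ ⌈4 * (Real.log n / Real.log t)⌉₊) ≤ 1 / n := by
  set L := Real.log n
  set a := ⌈4 * (L / Real.log t)⌉₊
  have hn0 : (0 : ℝ) < n := by positivity
  have hL : 0 < L := Real.log_pos (by exact_mod_cast hn)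
  have hlt : 0 < Real.log t := Real.log_pos ht
  have ht0 : 0 < t := by linarith
  have ha : 4 * (L / Real.log t) ≤ a := Nat.le_ceil _
  have ha0 : (0 : ℝ) < a := lt_of_lt_of_le (by positivity) ha
  have h1 : (n.choose a : ℝ) ≤ n ^ a / a.factorial := Nat.choose_le_pow_div a n
  have h2 : (a : ℝ) ^ a / a.factorial ≤ Real.exp 1 ^ a := by
    simpa [← Real.exp_nat_mul] using Real.pow_div_factorial_le_exp _ ha0.le a
  have h3 : Real.exp 1 * c * L / (t * a) ≤ Real.exp (-(Real.log t / 2)) := by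
    refine le_trans ?_ hct
    rw [div_le_div_iff₀ (by positivity) ht0]
    have h4 : 4 * L ≤ a * Real.log t := by
      rw [← mul_div_assoc, div_le_iff₀ hlt] at ha
      exact ha
    have := mul_le_mul_of_nonneg_left h4 (show 0 ≤ Real.exp 1 * c * t / 4 by positivity)
    nlinarith
  calc (n : ℝ) * (n.choose a * (c * (L / (n * t))) ^ a)
      ≤ n * (n ^ a / a.factorial * (c * (L / (n * t))) ^ a) := by gcongr
    _ = n * (((a : ℝ) ^ a / a.factorial) * (c * L / (t * a)) ^ a) := by
        have : c * (L / (n * t)) = (a / n) * (c * L / (t * a)) := by field_simp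
        rw [this, mul_pow, div_pow]
        field_simp
    _ ≤ n * (Real.exp 1 ^ a * (c * L / (t * a)) ^ a) := by gcongr
    _ = n * (Real.exp 1 * c * L / (t * a)) ^ a := by rw [← mul_pow]; ring
    _ ≤ n * Real.exp (-(Real.log t / 2)) ^ a := by gcongr
    _ ≤ n * Real.exp (-(2 * L)) := by
        rw [← Real.exp_nat_mul]
        gcongr
        rw [← mul_div_assoc, div_le_iff₀ hlt] at ha
        linarith
    _ = 1 / n := by
        rw [show -(2 * L) = -L + -L by ring, Real.exp_add, Real.exp_neg, Real.exp_log hn0]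
        field_simp

/-- Since `t ≤ n`, `L / log t ≥ 1` absorbs the rounding: `a ≤ 5 m`. With `k ≥ 10 m` the exponent is
at least `(5/2) k L`, against `n.choose k ≤ exp (k L)`. -/
theorem choose_mul_exp_le {n : ℕ} {t m : ℝ} (hn : 2 ≤ n) (ht : 1 < t) (htn : t ≤ n)
    (hm : Real.log n / Real.log t ≤ m) :
    (n.choose (⌊10 * m⌋₊ + 1) : ℝ) * Real.exp (-(Real.log n / m * (((⌊10 * m⌋₊ + 1 : ℕ) : ℝ) *
      (((⌊10 * m⌋₊ + 1 : ℕ) : ℝ) - ⌈4 * (Real.log n / Real.log t)⌉₊) / 2))) ≤ 1 / n := by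
  set L := Real.log n
  set a := ⌈4 * (L / Real.log t)⌉₊
  set k := ⌊10 * m⌋₊ + 1 with hkdef
  have hn0 : (0 : ℝ) < n := by positivity
  have hL : 0 < L := Real.log_pos (by exact_mod_cast hn)
  have hlt : 0 < Real.log t := Real.log_pos ht
  have h1 : 1 ≤ L / Real.log t := by
    rw [le_div_iff₀ hlt, one_mul]
    exact Real.log_le_log (by linarith) htn
  have hm0 : 0 < m := by linarith
  have ha : (a : ℝ) < 4 * (L / Real.log t) + 1 := Nat.ceil_lt_add_one (by positivity)
  have hk : 10 * m ≤ k := by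
    rw [hkdef]; push_cast
    exact (Nat.lt_floor_add_one _).le
  have hk1 : (1 : ℝ) ≤ k := by rw [hkdef]; push_cast; linarith [Nat.cast_nonneg (α := ℝ) ⌊10 * m⌋₊]
  have hka : 5 * m ≤ (k : ℝ) - a := by linarith
  have hmain : 2 * (k * L) ≤ L / m * (k * ((k : ℝ) - a) / 2) := by
    have h2 : L / m * (k * (5 * m) / 2) ≤ L / m * (k * ((k : ℝ) - a) / 2) := by gcongr
    have h3 : L / m * (k * (5 * m) / 2) = 5 / 2 * (k * L) := by field_simp
    have : 0 ≤ k * L := by positivity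
    linarith
  calc (n.choose k : ℝ) * Real.exp (-(L / m * (k * ((k : ℝ) - a) / 2)))
      ≤ Real.exp (k * L) * Real.exp (-(2 * (k * L))) := by
        gcongr
        rw [Real.exp_nat_mul, Real.exp_log hn0]
        exact_mod_cast Nat.choose_le_pow _ _
    _ = Real.exp (-(k * L)) := by rw [← Real.exp_add]; ring_nf
    _ ≤ Real.exp (-L) := by
        rw [Real.exp_le_exp]
        nlinarith
    _ = 1 / n := by rw [Real.exp_neg, Real.exp_log hn0, one_div]

/-! ### Consequences of the intermediate regime -/

theorem IntermediateRegime.tendsto_ratio {d : ℕ} {r : ℕ → ℝ} (hr : ∀ n, 0 < r n)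
    (h : IntermediateRegime d r) :
    Tendsto (fun n : ℕ => Real.log n / ((n : ℝ) * r n ^ d)) atTop atTop := by
  have h1 : Tendsto (fun n : ℕ => (n : ℝ) * r n ^ d / Real.log n) atTop (𝓝[>] 0) := by
    refine tendsto_nhdsWithin_iff.2 ⟨h.2, ?_⟩
    filter_upwards [eventually_ge_atTop 2] with n hn
    have hL : 0 < Real.log n := Real.log_pos (by exact_mod_cast hn)
    have := hr n
    have hn0 : (0 : ℝ) < n := by positivity
    exact Set.mem_Ioi.2 (by positivity)
  simpa [Function.comp_def, inv_div] using tendsto_inv_nhdsGT_zero.comp h1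

theorem IntermediateRegime.eventually_ratio_le {d : ℕ} {r : ℕ → ℝ} (hr : ∀ n, 0 < r n)
    (h : IntermediateRegime d r) :
    ∀ᶠ n : ℕ in atTop, Real.log n / ((n : ℝ) * r n ^ d) ≤ n := by
  -- The exponent `1/2` suffices: `n r^d ≥ n ^ (-1/2)` and `L ≤ n ^ (1/2)` eventually.
  have h1 := (h.1 (1 / 2) (by norm_num)).eventually_le_const zero_lt_one
  have h2 := ((isLittleO_log_rpow_atTop (r := 1 / 2) (by norm_num)).bound
    zero_lt_one).filter_mono tendsto_natCast_atTop_atTop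
  filter_upwards [h1, eventually_map.1 h2, eventually_ge_atTop 2] with n h1 h2 hn
  have hn0 : (0 : ℝ) < n := by positivity
  have hrn := hr n
  have hx : 0 < (n : ℝ) * r n ^ d := by positivity
  rw [div_le_one hx] at h1
  rw [div_le_iff₀ hx]
  have hL : 0 < Real.log n := Real.log_pos (by exact_mod_cast hn)
  rw [Real.norm_of_nonneg hL.le, one_mul, Real.norm_of_nonneg (by positivity)] at h2
  calc Real.log n ≤ (n : ℝ) ^ (1 / 2 : ℝ) := h2
    _ = n * (n : ℝ) ^ (-(1 / 2) : ℝ) := by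
        nth_rw 2 [← Real.rpow_one (n : ℝ)]
        rw [← Real.rpow_add hn0]; norm_num
    _ ≤ n * (n * r n ^ d) := by gcongr

theorem eventually_mul_log_div_le (c : ℝ) (hc : 0 < c) :
    ∀ᶠ t : ℝ in atTop, c * Real.log t / t ≤ Real.exp (-(Real.log t / 2)) := by
  filter_upwards [(isLittleO_log_rpow_atTop (r := 1 / 2) (by norm_num)).bound
    (inv_pos.2 hc), eventually_gt_atTop 1] with t ht h1
  have ht0 : 0 < t := by linarith
  rw [Real.norm_of_nonneg (Real.log_pos h1).le, Real.norm_of_nonneg (by positivity),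
    inv_mul_eq_div, le_div_iff₀ hc] at ht
  rw [div_le_iff₀ ht0]
  calc c * Real.log t ≤ t ^ (1 / 2 : ℝ) := by linarith
    _ = Real.exp (-(Real.log t / 2)) * t := by
        rw [Real.rpow_def_of_pos ht0]
        nth_rw 3 [← Real.exp_log ht0]
        rw [← Real.exp_add]; ring_nf

/-! ### The common bound and the two cases -/

theorem longEdgeCliqueBound_of_le_exp {d : ℕ} (N : Seminorm ℝ (Fin d → ℝ))
    (hN : ∀ x, N x = 0 → x = 0) (ν : Measure (Fin d → ℝ)) [IsProbabilityMeasure ν]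
    (hν : HasFiniteMaxDensity ν) (r : ℕ → ℝ) (hr : ∀ n, 0 < r n) (hreg : IntermediateRegime d r)
    (q : ℕ → unitInterval) (m : ℕ → ℝ)
    (hm : ∀ᶠ n : ℕ in atTop,
      Real.log n / Real.log (Real.log n / ((n : ℝ) * r n ^ d)) ≤ m n)
    (hq : ∀ᶠ n : ℕ in atTop, (q n : ℝ) ≤ Real.exp (-(Real.log n / m n))) :
    LongEdgeCliqueBound N ν r q m := by
  obtain ⟨c, hc, hball⟩ := exists_measure_normBall_le N hN ν hν
  refine ⟨10, by norm_num, ?_⟩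
  have ht := hreg.tendsto_ratio hr
  have hlim : Tendsto (fun n : ℕ => 1 - ENNReal.ofReal (1 / (n : ℝ) + 1 / n)) atTop (𝓝 1) := by
    have h0 : Tendsto (fun n : ℕ => ENNReal.ofReal (1 / (n : ℝ) + 1 / n)) atTop (𝓝 0) := by
      have := ENNReal.tendsto_ofReal ((tendsto_one_div_atTop_nhds_zero_nat (𝕜 := ℝ)).add
        (tendsto_one_div_atTop_nhds_zero_nat (𝕜 := ℝ)))
      simpa using this
    simpa using ENNReal.Tendsto.sub (tendsto_const_nhds (x := (1 : ENNReal))) h0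
      (Or.inl ENNReal.one_ne_top)
  have hprob : ∀ n, IsProbabilityMeasure (noisyLaw ν 0 (q n) n) := fun n => by
    unfold noisyLaw; infer_instance
  refine tendsto_of_tendsto_of_tendsto_of_le_of_le' hlim tendsto_const_nhds ?_
    (Eventually.of_forall fun n => prob_le_one)
  filter_upwards [hm, hq, ht.eventually (eventually_gt_atTop 1), hreg.eventually_ratio_le hr,
    ht.eventually (eventually_mul_log_div_le (Real.exp 1 * c / 4) (by positivity)),
    eventually_ge_atTop 2] with n hm hq ht1 htn hct hn
  set t := Real.log n / ((n : ℝ) * r n ^ d) with htdef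
  have hn0 : (0 : ℝ) < n := by positivity
  have hL : 0 < Real.log n := Real.log_pos (by exact_mod_cast hn)
  have hrn := hr n
  have hm0 : 0 < m n := lt_of_lt_of_le (div_pos hL (Real.log_pos ht1)) hm
  set a := ⌈4 * (Real.log n / Real.log t)⌉₊
  set k := ⌊10 * m n⌋₊ + 1 with hk
  have hp : c * r n ^ d = c * (Real.log n / (n * t)) := by
    rw [htdef]; field_simp
  have hbad := noisyLaw_exists_le_edgeCliqueNum_le (n := n) N ν (r n) hrn.le a k
    (Nat.succ_pos _) 0 (q n) (Real.log n / m n) (by positivity) hq _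
    (fun x => hball x (r n) hrn)
  have hsum : (n : ENNReal) * (n.choose a * ENNReal.ofReal (c * r n ^ d) ^ a) +
      n.choose k * ENNReal.ofReal (Real.exp (-(Real.log n / m n * (k * ((k : ℝ) - a) / 2)))) ≤
      ENNReal.ofReal (1 / (n : ℝ) + 1 / n) := by
    rw [← ENNReal.ofReal_pow (by positivity), ← ENNReal.ofReal_natCast n,
      ← ENNReal.ofReal_natCast (n.choose a), ← ENNReal.ofReal_natCast (n.choose k),
      ← ENNReal.ofReal_mul (by positivity), ← ENNReal.ofReal_mul (by positivity),
      ← ENNReal.ofReal_mul (by positivity), ← ENNReal.ofReal_add (by positivity) (by positivity)]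
    refine ENNReal.ofReal_le_ofReal (add_le_add ?_ ?_)
    · rw [hp]
      exact nat_mul_choose_mul_pow_le hn hc ht1 hct
    · exact choose_mul_exp_le hn ht1 htn hm
  -- Subadditivity on good and bad events avoids proving the good event measurable.
  rw [tsub_le_iff_right, ← measure_univ (μ := noisyLaw ν 0 (q n) n)]
  refine le_trans (measure_mono ?_) ((measure_union_le _ _).trans
    (add_le_add le_rfl (hbad.trans hsum)))
  intro ω _
  by_cases h : ∃ u v, k ≤ edgeCliqueNum (noisyGraph N (r n) ω) u v
  · exact Or.inr h
  · left
    push Not at h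
    intro u v _
    -- The `+ 1` in `k` makes "less than `k`" the same as "at most `10 m`".
    refine (Nat.le_floor_iff (by positivity)).1 ?_
    have := h u v
    omega

theorem theorem3p9 :
    ∃ C₁ C₂ ξ : ℕ → ℝ, (∀ β, 0 < C₁ β ∧ 0 < C₂ β ∧ 0 < ξ β) ∧
      ∀ (d : ℕ) (N : Seminorm ℝ (Fin d → ℝ)), (∀ x, N x = 0 → x = 0) →
      ∀ (ν : Measure (Fin d → ℝ)), IsProbabilityMeasure ν → HasFiniteMaxDensity ν →
      ∀ (r : ℕ → ℝ), (∀ n, 0 < r n) → Tendsto r atTop (𝓝 0) → IntermediateRegime d r →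
      ∀ (q : ℕ → unitInterval),
        ((∀ᶠ n : ℕ in atTop, (q n : ℝ) ≤
            C₁ (besicovitchConstant N) *
              ((n : ℝ) * r n ^ d / Real.log n) ^ C₂ (besicovitchConstant N)) →
          LongEdgeCliqueBound N ν r q
            (fun n => Real.log n / Real.log (Real.log n / ((n : ℝ) * r n ^ d)))) ∧
        ((∀ᶠ n : ℕ in atTop,
            ((n : ℝ) * r n ^ d / Real.log n) ^ ξ (besicovitchConstant N) ≤ (q n : ℝ) ∧
              (q n : ℝ) < 1) →
          LongEdgeCliqueBound N ν r q (fun n => Real.logb (1 / (q n : ℝ)) n)) := by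
  refine ⟨fun _ => 1, fun _ => 1, fun _ => 1, fun _ => by norm_num, ?_⟩
  intro d N hN ν _ hν r hr _ hreg q
  have ht := (hreg.tendsto_ratio hr).eventually (eventually_gt_atTop 1)
  simp only [Real.rpow_one, one_mul]
  refine ⟨fun hq => ?_, fun hq => ?_⟩
  · refine longEdgeCliqueBound_of_le_exp N hN ν hν r hr hreg q _
      (Eventually.of_forall fun n => le_rfl) ?_
    filter_upwards [hq, ht, eventually_ge_atTop 2] with n hq ht hn
    have hL : 0 < Real.log n := Real.log_pos (by exact_mod_cast hn)
    rwa [div_div_cancel₀ hL.ne', Real.exp_neg, Real.exp_log (by linarith), inv_div]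
  · have hpos : ∀ᶠ n : ℕ in atTop, 0 < (q n : ℝ) := by
      filter_upwards [hq, eventually_ge_atTop 2] with n hq hn
      have hL : 0 < Real.log n := Real.log_pos (by exact_mod_cast hn)
      have hn0 : (0 : ℝ) < n := by positivity
      have := hr n
      exact lt_of_lt_of_le (by positivity) hq.1
    refine longEdgeCliqueBound_of_le_exp N hN ν hν r hr hreg q _ ?_ ?_
    · filter_upwards [hq, hpos, ht, eventually_ge_atTop 2] with n hq hpos ht hn
      have hL : 0 < Real.log n := Real.log_pos (by exact_mod_cast hn)
      have h1 : 0 < Real.log (1 / (q n : ℝ)) := Real.log_pos ((one_lt_div hpos).2 hq.2)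
      rw [Real.logb]
      -- `q ≥ 1 / t` means `log (1/q) ≤ log t`.
      refine div_le_div_of_nonneg_left hL.le h1 (Real.log_le_log (by positivity) ?_)
      rw [one_div, ← inv_div]
      have h0 : 0 < (n : ℝ) * r n ^ d / Real.log n := by
        rw [← inv_div]; exact inv_pos.2 (by linarith)
      exact inv_anti₀ h0 hq.1
    · filter_upwards [hpos, eventually_ge_atTop 2] with n hpos hn
      have hL : 0 < Real.log n := Real.log_pos (by exact_mod_cast hn)
      -- Here `exp (-L / m)` equals `q` exactly.
      rw [Real.logb, div_div_cancel₀ hL.ne', Real.exp_neg, Real.exp_log (by positivity)]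
      simp
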